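/- For $0<\theta\le 1$ and an integer $N\ge 1$, the single-well random walk between $-N$ and $N$ with parameter $\theta$ is a Markov chain $(X^{(N)}_n)_{n\ge 0}$ with integer values, started at $X^{(N)}_0=0$, whose transition probabilities satisfy $$Q(x,x+1)=\theta,\quad Q(x,x-1)=1-\theta\qquad(1\le x\le N-1),$$ $$Q(x,x+1)=1-\theta,\quad Q(x,x-1)=\theta\qquad(-N+1\le x\le 0);$$ the transition probabilities from all other points (in particular from $\pm N$) are arbitrary, as they do not influence the walk before it hits $\{-N,N\}$. Let $\tau_N=\inf\{n\ge 0: X^{(N)}_n\in\{-N,N\}\}$, and write $P_\theta$, $E_\theta$ for probability and expectation. **Theorem.** For every $\theta\in(0,1/2)\cup(1/2,1]$ and every $N\ge1$ one has $0<E_\theta[\tau_N]<\infty$. Moreover: (i) If $0<\theta<1/2$, then $\tau_N/E_\theta[\tau_N]$ converges in distribution, as $N\to\infty$, to an exponential random variable with parameter $1$. In particular the state $\theta$ is metastable, i.e. $$P_\theta\big(\tau_N/E_\theta[\tau_N]>t\big)\longrightarrow e^{-t}\quad\text{as } N\to\infty,\text{ for every } t\ge 0.$$ (ii) If $1/2<\theta\le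 1$, and the walks $X^{(N)}$, $N\ge 1$, are defined on a common probability space (with an arbitrary joint law), then $$\frac{\tau_N}{E_\theta[\tau_N]}\longrightarrow 1\quad\text{almost surely, as } N\to\infty.$$ In particular the state $\theta$ shows cut-off, i.e. there are constants $c_1,c_2>0$, independent of $N$, with $$P_\theta\big(c_1<\tau_N/E_\theta[\tau_N]<c_2\big)\longrightarrow 1\quad\text{as } N\to\infty.$$ -/

import Mathlib

open MeasureTheory ProbabilityTheory Filter Topology
open scoped ENNReal

namespace SingleWell

/-- `Q` is a stochastic matrix on `S`: nonnegative entries and rows of total mass one. -/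
structure IsStochastic {S : Type*} (Q : S → S → ℝ) : Prop where
  nonneg : ∀ x y, 0 ≤ Q x y
  row_sum : ∀ x, HasSum (Q x) 1

/-- Under `P`, the process `X` is a (time-homogeneous, discrete-time) Markov chain with
transition matrix `Q`, started at `x₀`. The Markov property is stated on cylinders:
`P(X₀ = s₀, …, Xₙ₊₁ = sₙ₊₁) = P(X₀ = s₀, …, Xₙ = sₙ) Q(sₙ, sₙ₊₁)`. -/
structure IsMarkovChain {S : Type*} [MeasurableSpace S] {Ω : Type*} [MeasurableSpace Ω]
    (P : Measure Ω) (Q : S → S → ℝ) (x₀ : S) (X : ℕ → Ω → S) : Prop where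
  measurable : ∀ n, Measurable (X n)
  start : ∀ᵐ ω ∂P, X 0 ω = x₀
  step : ∀ (n : ℕ) (s : ℕ → S),
    P.real {ω | ∀ k ≤ n + 1, X k ω = s k} = P.real {ω | ∀ k ≤ n, X k ω = s k} * Q (s n) (s (n + 1))

/-- The single-well transition probabilities in the state `θ`: from `x ≥ 1` the walk goes right
with probability `θ` and left with probability `1 - θ`; from `x ≤ 0` it goes left with
probability `θ` and right with probability `1 - θ`. -/
noncomputable def transition (θ : ℝ) (x y : ℤ) : ℝ :=
  if 1 ≤ x then
    if y = x + 1 then θ else if y = x - 1 then 1 - θ else 0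
  else
    if y = x + 1 then 1 - θ else if y = x - 1 then θ else 0

/-- `X` is a single-well random walk between `-N` and `N` in the state `θ`, started at `0`: a Markov
chain from `0` whose transition matrix has the single-well rows at every `x ∈ [-N + 1, N - 1]`.
The rows at `-N` and `N` are arbitrary, since they do not influence the walk before it hits
`{-N, N}`. The chain is regarded as taking values in `ℤ`, and the rows outside `[-N, N]` are
arbitrary for the same reason. So this comprises the chains that live on `[-N, N]` and
are, for instance, absorbed at `-N` and `N` or restarted at `0` from there, and also
the walk on all of `ℤ` with the single-well rows everywhere. -/
def IsWalk {Ω : Type*} [MeasurableSpace Ω] (P : Measure Ω) (θ : ℝ) (N : ℕ)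
    (X : ℕ → Ω → ℤ) : Prop :=
  ∃ Q : ℤ → ℤ → ℝ, IsStochastic Q ∧
    (∀ x : ℤ, -(N : ℤ) < x → x < N → ∀ y, Q x y = transition θ x y) ∧
    IsMarkovChain P Q 0 X

/-- `τ_N`: the first time the process `X` hits the target set `{-N, N}` (`⊤` if it never does). -/
noncomputable def hitTime {Ω : Type*} (N : ℕ) (X : ℕ → Ω → ℤ) (ω : Ω) : ℕ∞ :=
  hittingAfter X {-(N : ℤ), (N : ℤ)} 0 ω

/-- `E[τ]`, with values in `[0, ∞]`. -/
noncomputable def mean {Ω : Type*} [MeasurableSpace Ω] (P : Measure Ω) (τ : Ω → ℕ∞) : ℝ≥0∞ :=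
  ∫⁻ ω, (τ ω : ℝ≥0∞) ∂P

/-- `τ / E[τ]`, as a real random variable. It is meaningful when `0 < E[τ] < ∞`, and then `τ` is
almost surely finite. -/
noncomputable def normalized {Ω : Type*} [MeasurableSpace Ω] (P : Measure Ω) (τ : Ω → ℕ∞)
    (ω : Ω) : ℝ :=
  ((τ ω : ℝ≥0∞) / mean P τ).toReal

/-- Metastability: `P_N(τ_N / E[τ_N] > t) → exp(-t)` as `N → ∞`, for all `t ≥ 0`. -/
def Metastable {Ω : ℕ+ → Type*} [∀ N, MeasurableSpace (Ω N)] (P : ∀ N, Measure (Ω N))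
    (τ : ∀ N, Ω N → ℕ∞) : Prop :=
  ∀ t : ℝ, 0 ≤ t →
    Tendsto (fun N => (P N).real {ω | t < normalized (P N) (τ N) ω}) atTop (𝓝 (Real.exp (-t)))

/-- Cut-off: there are constants `c₁, c₂ > 0` such that `P_N(c₁ < τ_N / E[τ_N] < c₂) → 1`
as `N → ∞`. -/
def CutOff {Ω : ℕ+ → Type*} [∀ N, MeasurableSpace (Ω N)] (P : ∀ N, Measure (Ω N))
    (τ : ∀ N, Ω N → ℕ∞) : Prop :=
  ∃ c₁ c₂ : ℝ, 0 < c₁ ∧ 0 < c₂ ∧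
    Tendsto (fun N => (P N).real {ω | c₁ < normalized (P N) (τ N) ω ∧
      normalized (P N) (τ N) ω < c₂}) atTop (𝓝 1)

instance isProbabilityMeasure_exp_one : IsProbabilityMeasure (expMeasure 1) :=
  isProbabilityMeasure_expMeasure one_pos

end SingleWell

/-! Since the two outward probabilities agree, `|X|` is itself a nearest-neighbour chain: it steps
from `0` to `1` surely, and from `k ≥ 1` it moves outwards with probability `θ` and inwards with
probability `1 - θ`. The law of `τ_N` is carried by the tails `survival θ N n = P(τ_N > n)`, and
everything follows by applying the one-step relation `killed_foldStep` to suitable test functions of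
`|X|`. Write `E` for `expectedTime θ N` and `β = (1 - θ) / θ`.

The function `remaining` loses exactly `1` per step and vanishes at `N`, so the tails sum to `E`,
which is the mean (`hasSum_survival`).

If `θ < 1/2`, then `E` grows at least like `β ^ N`, while a Lyapunov function `a ^ k` with `1 < a <
β` keeps the walk near `0`, where the remaining time is almost `E`. The killed mean of `remaining`
therefore decays by a factor close to `1 - 1 / E` per step. The tails are geometric up to an error
of order `a⁻¹ ^ N` uniformly in time (`exists_abs_survival_sub_le`), and the exponential limit
follows.

If `θ > 1/2`, exponential test functions show that `τ_N` leaves `[(1 - ε) N / (2θ - 1), (1 + ε) N /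
(2θ - 1)]` with probability exponentially small in `N`. The Borel-Cantelli half that requires no
independence gives almost sure convergence for any joint law, because `E / N` also tends to `1 / (2θ
- 1)`. -/

/-! ### The killed walk and its one-step relation -/

namespace SingleWell

/-- `occupation θ N n x` is the probability that the walk stays strictly between `-N` and `N`
before time `n` and is at `x` at time `n`. -/
noncomputable def occupation (θ : ℝ) (N : ℕ) : ℕ → ℤ → ℝ
  | 0, x => if x = 0 then 1 else 0
  | n + 1, y => ∑ x ∈ Finset.Ioo (-(N : ℤ)) N, occupation θ N n x * transition θ x y

/-- `killed θ N n g` is the expectation of `g |Xₙ|` on the event that the walk has not left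
`(-N, N)` up to time `n`. -/
noncomputable def killed (θ : ℝ) (N n : ℕ) (g : ℕ → ℝ) : ℝ :=
  ∑ x ∈ Finset.Ioo (-(N : ℤ)) N, occupation θ N n x * g x.natAbs

/-- The probability that the walk has not left `(-N, N)` up to time `n`. -/
noncomputable def survival (θ : ℝ) (N n : ℕ) : ℝ := killed θ N n fun _ => 1

/-- The transition operator of the absolute value of the walk. -/
def foldStep (θ : ℝ) (g : ℕ → ℝ) : ℕ → ℝ
  | 0 => g 1
  | k + 1 => θ * g (k + 2) + (1 - θ) * g k

variable {θ : ℝ} {N : ℕ}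

lemma transition_nonneg (h0 : 0 ≤ θ) (h1 : θ ≤ 1) (x y : ℤ) : 0 ≤ transition θ x y := by
  unfold transition; split_ifs <;> linarith

lemma transition_eq (x y : ℤ) : transition θ x y =
    (if y = x + 1 then (if 1 ≤ x then θ else 1 - θ) else 0) +
      (if y = x - 1 then (if 1 ≤ x then 1 - θ else θ) else 0) := by
  have : y = x + 1 → ¬ y = x - 1 := by omega
  unfold transition; split_ifs <;> simp_all

lemma occupation_nonneg (h0 : 0 ≤ θ) (h1 : θ ≤ 1) (n : ℕ) (x : ℤ) : 0 ≤ occupation θ N n x := by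
  induction n generalizing x with
  | zero => unfold occupation; split_ifs <;> simp
  | succ n ih =>
    exact Finset.sum_nonneg fun y _ => mul_nonneg (ih y) (transition_nonneg h0 h1 y x)

/-- This is where the symmetry of the well enters: at `0` both neighbours have absolute value `1`,
and on either side `θ` is the outward probability. -/
lemma sum_transition_mul (g : ℕ → ℝ) {x : ℤ} (hx : x ∈ Finset.Ioo (-(N : ℤ)) N) :
    ∑ y ∈ Finset.Icc (-(N : ℤ)) N, transition θ x y * g y.natAbs = foldStep θ g x.natAbs := by
  rw [Finset.mem_Ioo] at hx
  simp only [transition_eq, add_mul, ite_zero_mul, Finset.sum_add_distrib,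
    Finset.sum_ite_eq', Finset.mem_Icc]
  rw [if_pos (show -(N : ℤ) ≤ x + 1 ∧ x + 1 ≤ N by omega),
    if_pos (show -(N : ℤ) ≤ x - 1 ∧ x - 1 ≤ N by omega)]
  rcases h : x.natAbs with _ | k
  · obtain rfl : x = 0 := by omega
    norm_num [foldStep]
    ring
  · rcases le_or_gt 1 x with h1 | h1
    · rw [if_pos h1, if_pos h1, show (x + 1).natAbs = k + 2 by omega,
        show (x - 1).natAbs = k by omega, foldStep]
    · rw [if_neg (by omega), if_neg (by omega), show (x + 1).natAbs = k by omega,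
        show (x - 1).natAbs = k + 2 by omega, foldStep]
      ring

/-- One step from inside ends in `[-N, N]`. Splitting off the endpoints, where `g` takes the common
value `g N`, separates the surviving mass from the absorbed mass; taking `g = 1` then identifies the
latter as the drop in survival. -/
lemma killed_foldStep_aux (hN : 0 < N) (n : ℕ) (g : ℕ → ℝ) :
    killed θ N n (foldStep θ g) = killed θ N (n + 1) g +
      g N * (occupation θ N (n + 1) (-N) + occupation θ N (n + 1) N) := by
  have key : killed θ N n (foldStep θ g) =
      ∑ y ∈ Finset.Icc (-(N : ℤ)) N, occupation θ N (n + 1) y * g y.natAbs := by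
    simp only [killed, occupation, Finset.sum_mul]
    rw [Finset.sum_comm]
    refine Finset.sum_congr rfl fun x hx => ?_
    rw [← sum_transition_mul g hx, Finset.mul_sum]
    exact Finset.sum_congr rfl fun y _ => by ring
  rw [key, ← Finset.Ico_insert_right (by omega), ← Finset.Ioo_insert_left (by omega),
    Finset.sum_insert (by simp; omega), Finset.sum_insert (by simp), killed]
  simp only [Int.natAbs_neg, Int.natAbs_natCast]
  ring

lemma foldStep_one : foldStep θ (fun _ => 1) = fun _ => 1 := by
  funext k; cases k <;> simp [foldStep]

/-- The one-step relation for the walk killed at `±N`. -/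
lemma killed_foldStep (hN : 0 < N) (n : ℕ) (g : ℕ → ℝ) :
    killed θ N n (foldStep θ g) = killed θ N (n + 1) g +
      g N * (survival θ N n - survival θ N (n + 1)) := by
  have h := killed_foldStep_aux (θ := θ) hN n fun _ => 1
  rw [foldStep_one] at h
  rw [killed_foldStep_aux hN, survival, survival, h]
  ring

lemma killed_zero (hN : 0 < N) (g : ℕ → ℝ) : killed θ N 0 g = g 0 := by
  simp only [killed, occupation, ite_mul, one_mul, zero_mul, Finset.sum_ite_eq', Finset.mem_Ioo]
  rw [if_pos (by omega), Int.natAbs_zero]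

lemma killed_mono (h0 : 0 ≤ θ) (h1 : θ ≤ 1) (n : ℕ) {f g : ℕ → ℝ} (h : ∀ k < N, f k ≤ g k) :
    killed θ N n f ≤ killed θ N n g := by
  refine Finset.sum_le_sum fun x hx => ?_
  rw [Finset.mem_Ioo] at hx
  exact mul_le_mul_of_nonneg_left (h _ (by omega)) (occupation_nonneg h0 h1 n x)

lemma killed_congr (n : ℕ) {f g : ℕ → ℝ} (h : ∀ k < N, f k = g k) :
    killed θ N n f = killed θ N n g := by
  refine Finset.sum_congr rfl fun x hx => ?_
  rw [Finset.mem_Ioo] at hx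
  rw [h _ (by omega)]

lemma killed_add (n : ℕ) (f g : ℕ → ℝ) :
    killed θ N n (fun k => f k + g k) = killed θ N n f + killed θ N n g := by
  simp only [killed, mul_add, Finset.sum_add_distrib]

lemma killed_mul (n : ℕ) (c : ℝ) (g : ℕ → ℝ) :
    killed θ N n (fun k => c * g k) = c * killed θ N n g := by
  simp only [killed, Finset.mul_sum]
  exact Finset.sum_congr rfl fun x _ => by ring

lemma killed_const (n : ℕ) (c : ℝ) : killed θ N n (fun _ => c) = c * survival θ N n := by
  rw [survival, ← killed_mul]; simp

lemma killed_nonneg (h0 : 0 ≤ θ) (h1 : θ ≤ 1) (n : ℕ) {g : ℕ → ℝ} (h : ∀ k < N, 0 ≤ g k) :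
    0 ≤ killed θ N n g := by
  simpa [killed_const] using killed_mono h0 h1 n (f := fun _ => 0) h

lemma survival_zero (hN : 0 < N) : survival θ N 0 = 1 := killed_zero hN _

lemma survival_nonneg (h0 : 0 ≤ θ) (h1 : θ ≤ 1) (n : ℕ) : 0 ≤ survival θ N n :=
  killed_nonneg h0 h1 n fun _ _ => zero_le_one

lemma survival_succ_le (h0 : 0 ≤ θ) (h1 : θ ≤ 1) (hN : 0 < N) (n : ℕ) :
    survival θ N (n + 1) ≤ survival θ N n := by
  have h := killed_foldStep_aux (θ := θ) hN n fun _ => 1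
  rw [foldStep_one] at h
  have h2 := occupation_nonneg (N := N) h0 h1 (n + 1) (-N)
  have h3 := occupation_nonneg (N := N) h0 h1 (n + 1) N
  unfold survival
  linarith

lemma survival_le_one (h0 : 0 ≤ θ) (h1 : θ ≤ 1) (hN : 0 < N) (n : ℕ) : survival θ N n ≤ 1 := by
  induction n with
  | zero => exact (survival_zero hN).le
  | succ n ih => exact (survival_succ_le h0 h1 hN n).trans ih

lemma killed_succ_le (h0 : 0 ≤ θ) (h1 : θ ≤ 1) (hN : 0 < N) (n : ℕ) {g : ℕ → ℝ} (hg : 0 ≤ g N) :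
    killed θ N (n + 1) g ≤ killed θ N n (foldStep θ g) := by
  rw [killed_foldStep hN]
  have := mul_nonneg hg (sub_nonneg.2 (survival_succ_le h0 h1 hN n))
  linarith

/-! ### Expected hitting time and the tail sum -/

/-- The expected time that the absolute value of the walk needs to get from `k` to `k + 1`. -/
noncomputable def climb (θ : ℝ) : ℕ → ℝ
  | 0 => 1
  | k + 1 => (1 - θ) / θ * climb θ k + 1 / θ

lemma climb_pos (h0 : 0 < θ) (h1 : θ ≤ 1) (k : ℕ) : 0 < climb θ k := by
  induction k with
  | zero => simp [climb]
  | succ k ih =>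
    have : 0 ≤ (1 - θ) / θ * climb θ k := mul_nonneg (div_nonneg (by linarith) h0.le) ih.le
    have : 0 < 1 / θ := by positivity
    unfold climb; linarith

/-- The expected hitting time of `{-N, N}` for the walk started at `0`. -/
noncomputable def expectedTime (θ : ℝ) (N : ℕ) : ℝ := ∑ j ∈ Finset.range N, climb θ j

lemma one_le_expectedTime (h0 : 0 < θ) (h1 : θ ≤ 1) (hN : 0 < N) : 1 ≤ expectedTime θ N := by
  have := Finset.single_le_sum (f := climb θ) (fun i _ => (climb_pos h0 h1 i).le)
    (Finset.mem_range.2 hN)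
  simpa [climb, expectedTime] using this

/-- The expected hitting time of `{-N, N}` for the walk started at distance `k` from `0`. -/
noncomputable def remaining (θ : ℝ) (N k : ℕ) : ℝ :=
  expectedTime θ N - ∑ j ∈ Finset.range k, climb θ j

lemma foldStep_remaining (h0 : 0 < θ) (k : ℕ) :
    foldStep θ (remaining θ N) k = remaining θ N k - 1 := by
  cases k with
  | zero => simp [foldStep, remaining, climb]
  | succ k =>
    simp only [foldStep, remaining, Finset.sum_range_succ, climb]
    field_simp
    ring

lemma remaining_self : remaining θ N N = 0 := by simp [remaining, expectedTime]

lemma remaining_zero : remaining θ N 0 = expectedTime θ N := by simp [remaining]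

lemma remaining_le (h0 : 0 < θ) (h1 : θ ≤ 1) (k : ℕ) : remaining θ N k ≤ expectedTime θ N :=
  sub_le_self _ (Finset.sum_nonneg fun i _ => (climb_pos h0 h1 i).le)

lemma remaining_nonneg (h0 : 0 < θ) (h1 : θ ≤ 1) {k : ℕ} (hk : k ≤ N) : 0 ≤ remaining θ N k :=
  sub_nonneg.2 (Finset.sum_le_sum_of_subset_of_nonneg (Finset.range_mono hk)
    fun i _ _ => (climb_pos h0 h1 i).le)

lemma killed_remaining_succ (h0 : 0 < θ) (hN : 0 < N) (n : ℕ) :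
    killed θ N (n + 1) (remaining θ N) = killed θ N n (remaining θ N) - survival θ N n := by
  have h := killed_foldStep (θ := θ) hN n (remaining θ N)
  rw [remaining_self, zero_mul, add_zero] at h
  rw [← h, killed_congr n (g := fun k => remaining θ N k + -1)
    (fun k _ => (foldStep_remaining h0 k).trans (sub_eq_add_neg _ _)), killed_add, killed_const]
  ring

lemma sum_survival (h0 : 0 < θ) (hN : 0 < N) (n : ℕ) :
    ∑ k ∈ Finset.range n, survival θ N k = expectedTime θ N - killed θ N n (remaining θ N) := by
  induction n with
  | zero => simp [killed_zero hN, remaining_zero]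
  | succ n ih => rw [Finset.sum_range_succ, ih, killed_remaining_succ h0 hN]; ring

/-- The recursion for the killed mean of `remaining` telescopes. Its boundary term is at most `E`
times the survival probability, which tends to `0` because bounded partial sums already make the
tails summable. -/
lemma hasSum_survival (h0 : 0 < θ) (h1 : θ ≤ 1) (hN : 0 < N) :
    HasSum (survival θ N) (expectedTime θ N) := by
  have hnn : ∀ n, 0 ≤ killed θ N n (remaining θ N) := fun n =>
    killed_nonneg h0.le h1 n fun k hk => remaining_nonneg h0 h1 hk.le
  have hs : Summable (survival θ N) :=
    summable_of_sum_range_le (fun n => survival_nonneg h0.le h1 n) (c := expectedTime θ N)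
      fun n => by rw [sum_survival h0 hN]; linarith [hnn n]
  rw [hasSum_iff_tendsto_nat_of_nonneg (fun n => survival_nonneg h0.le h1 n)]
  simp only [sum_survival h0 hN]
  have hk : Tendsto (fun n => killed θ N n (remaining θ N)) atTop (𝓝 0) := by
    refine squeeze_zero hnn (fun n => ?_)
      (by simpa using hs.tendsto_atTop_zero.const_mul (expectedTime θ N))
    rw [← killed_const]
    exact killed_mono h0.le h1 n fun k _ => remaining_le h0 h1 k
  simpa using tendsto_const_nhds.sub hk

end SingleWell

/-! ### Inward drift: comparison with a geometric law -/

namespace SingleWell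

variable {θ : ℝ} {N : ℕ}

/-- Lyapunov bound: away from `0` a step multiplies `a ^ k` by `γ < 1`, and at `0` it produces at
most an extra `a`. The map `x ↦ γ x + a` preserves the bound, whatever the time and `N`. -/
lemma killed_pow_le (h0 : 0 ≤ θ) (h1 : θ ≤ 1) (hN : 0 < N) {a : ℝ} (ha : 1 ≤ a)
    (hγ : θ * a + (1 - θ) / a < 1) (n : ℕ) :
    killed θ N n (fun k => a ^ k) ≤ 1 + a / (1 - (θ * a + (1 - θ) / a)) := by
  set γ := θ * a + (1 - θ) / a with hγdef
  have ha0 : 0 < a := by linarith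
  have hγ0 : 0 ≤ γ := add_nonneg (by positivity) (div_nonneg (by linarith) ha0.le)
  have hstep : ∀ k, foldStep θ (fun k => a ^ k) k ≤ γ * a ^ k + a := by
    intro k
    cases k with
    | zero => simp [foldStep, hγ0]
    | succ k =>
      have : θ * a ^ (k + 2) + (1 - θ) * a ^ k = γ * a ^ (k + 1) := by
        rw [hγdef]; field_simp; ring
      simp only [foldStep]
      linarith
  have h1γ : 0 < 1 - γ := by linarith
  induction n with
  | zero =>
    rw [killed_zero hN, pow_zero]
    have : 0 ≤ a / (1 - γ) := by positivity
    linarith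
  | succ n ih =>
    calc killed θ N (n + 1) (fun k => a ^ k)
        ≤ killed θ N n (foldStep θ fun k => a ^ k) := killed_succ_le h0 h1 hN n (by positivity)
      _ ≤ killed θ N n (fun k => γ * a ^ k + a) := killed_mono h0 h1 n fun k _ => hstep k
      _ = γ * killed θ N n (fun k => a ^ k) + a * survival θ N n := by
        rw [killed_add, killed_mul, killed_const]
      _ ≤ γ * (1 + a / (1 - γ)) + a * 1 :=
        add_le_add (mul_le_mul_of_nonneg_left ih hγ0)
          (mul_le_mul_of_nonneg_left (survival_le_one h0 h1 hN n) ha0.le)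
      _ ≤ 1 + a / (1 - γ) := by
        have : γ * (a / (1 - γ)) + a = a / (1 - γ) := by field_simp; ring
        linarith

lemma climb_add_eq (h0 : 0 < θ) (h : 1 - 2 * θ ≠ 0) (k : ℕ) :
    climb θ k = ((1 - θ) / θ) ^ k * (1 + 1 / (1 - 2 * θ)) - 1 / (1 - 2 * θ) := by
  induction k with
  | zero => simp [climb]
  | succ k ih =>
    have hc : 1 / (1 - 2 * θ) * (1 - 2 * θ) = 1 := one_div_mul_cancel h
    generalize 1 / (1 - 2 * θ) = c at hc ih ⊢
    have e : (1 - θ) / θ * c - c = 1 / θ := by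
      field_simp; linear_combination hc
    rw [climb, ih, pow_succ]
    linear_combination -e

lemma pow_le_climb (h0 : 0 < θ) (h1 : θ ≤ 1) (k : ℕ) : ((1 - θ) / θ) ^ k ≤ climb θ k := by
  induction k with
  | zero => simp [climb]
  | succ k ih =>
    have hβ : 0 ≤ (1 - θ) / θ := div_nonneg (by linarith) h0.le
    have : 0 < 1 / θ := by positivity
    rw [pow_succ, climb, mul_comm]
    linarith [mul_le_mul_of_nonneg_left ih hβ]

lemma one_lt_ratio (h0 : 0 < θ) (h : θ < 1 / 2) : 1 < (1 - θ) / θ := by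
  rw [lt_div_iff₀ h0]; linarith

lemma pow_le_expectedTime (h0 : 0 < θ) (h1 : θ ≤ 1) (hN : 0 < N) :
    ((1 - θ) / θ) ^ N ≤ (1 - θ) / θ * expectedTime θ N := by
  obtain ⟨M, rfl⟩ : ∃ M, N = M + 1 := ⟨N - 1, by omega⟩
  have hβ : 0 ≤ (1 - θ) / θ := div_nonneg (by linarith) h0.le
  rw [pow_succ, mul_comm]
  refine mul_le_mul_of_nonneg_left ((pow_le_climb h0 h1 M).trans ?_) hβ
  exact Finset.single_le_sum (f := climb θ) (fun i _ => (climb_pos h0 h1 i).le)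
    (Finset.self_mem_range_succ M)

lemma tendsto_expectedTime_atTop (h0 : 0 < θ) (h : θ < 1 / 2) :
    Tendsto (expectedTime θ) atTop atTop := by
  have hβ := one_lt_ratio h0 h
  have h2 : Tendsto (fun N => ((1 - θ) / θ)⁻¹ * ((1 - θ) / θ) ^ N) atTop atTop :=
    (tendsto_pow_atTop_atTop_of_one_lt hβ).const_mul_atTop (by positivity)
  refine tendsto_atTop_mono' _ ?_ h2
  filter_upwards [eventually_gt_atTop 0] with N hN
  rw [inv_mul_le_iff₀ (by linarith)]
  exact pow_le_expectedTime h0 (by linarith) hN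

lemma exists_sum_climb_le (h0 : 0 < θ) (h : θ < 1 / 2) :
    ∃ C : ℝ, 0 ≤ C ∧ ∀ k, ∑ j ∈ Finset.range k, climb θ j ≤ C * ((1 - θ) / θ) ^ k := by
  have hβ := one_lt_ratio h0 h
  have hc : 0 < 1 / (1 - 2 * θ) := by apply one_div_pos.2; linarith
  set β := (1 - θ) / θ with hβd
  set c := 1 / (1 - 2 * θ) with hcd
  have hβ1 : 0 < β - 1 := by linarith
  refine ⟨(1 + c) / (β - 1), by positivity, fun k => ?_⟩
  calc ∑ j ∈ Finset.range k, climb θ j ≤ ∑ j ∈ Finset.range k, β ^ j * (1 + c) := by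
        refine Finset.sum_le_sum fun j _ => ?_
        rw [climb_add_eq h0 (by linarith)]
        linarith
    _ = (β ^ k - 1) / (β - 1) * (1 + c) := by rw [← Finset.sum_mul, geom_sum_eq hβ.ne']
    _ ≤ β ^ k / (β - 1) * (1 + c) := by gcongr; linarith
    _ = (1 + c) / (β - 1) * β ^ k := by ring

/-- If the killed walk is typically at points from which the remaining time is close to the
expected one, then the survival probabilities are close to those of a geometric distribution. -/
lemma abs_survival_sub_le (h0 : 0 < θ) (h1 : θ ≤ 1) (hN : 0 < N) {ε : ℝ}
    (hε : ∀ n, killed θ N n (fun k => expectedTime θ N - remaining θ N k) ≤ ε * expectedTime θ N)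
    (n : ℕ) : |survival θ N n - (1 - 1 / expectedTime θ N) ^ n| ≤ 2 * ε := by
  set E := expectedTime θ N with hE
  have hE1 : 1 ≤ E := one_le_expectedTime h0 h1 hN
  have hE0 : 0 < E := by linarith
  have hr : 0 ≤ 1 - 1 / E := by
    rw [sub_nonneg, div_le_one hE0]; exact hE1
  have hdef : ∀ n, killed θ N n (fun k => E - remaining θ N k) =
      E * survival θ N n - killed θ N n (remaining θ N) := by
    intro n
    have := killed_add (θ := θ) (N := N) n (fun k => E - remaining θ N k) (remaining θ N)
    simp only [sub_add_cancel, killed_const] at this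
    linarith
  have hlow : ∀ n, 0 ≤ E * survival θ N n - killed θ N n (remaining θ N) := fun n => by
    rw [← hdef]
    exact killed_nonneg h0.le h1 n fun k _ => sub_nonneg.2 (remaining_le h0 h1 k)
  have hup : ∀ n, E * survival θ N n - killed θ N n (remaining θ N) ≤ ε * E := fun n => by
    rw [← hdef]; exact hε n
  -- Errors do not accumulate: the old one is multiplied by `1 - 1 / E` and the new one enters with
  -- weight `1 / E`, so `ε * E` is preserved.
  have hmain : ∀ n, |killed θ N n (remaining θ N) - E * (1 - 1 / E) ^ n| ≤ ε * E := by
    intro n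
    induction n with
    | zero =>
      rw [killed_zero hN, remaining_zero, ← hE]
      simpa using (hlow 0).trans (hup 0)
    | succ n ih =>
      rw [killed_remaining_succ h0 hN]
      have e : killed θ N n (remaining θ N) - survival θ N n - E * (1 - 1 / E) ^ (n + 1) =
          (1 - 1 / E) * (killed θ N n (remaining θ N) - E * (1 - 1 / E) ^ n) -
            1 / E * (E * survival θ N n - killed θ N n (remaining θ N)) := by
        rw [pow_succ]; field_simp; ring
      rw [e]
      calc _ ≤ |(1 - 1 / E) * (killed θ N n (remaining θ N) - E * (1 - 1 / E) ^ n)| +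
            |1 / E * (E * survival θ N n - killed θ N n (remaining θ N))| := abs_sub _ _
        _ ≤ (1 - 1 / E) * (ε * E) + 1 / E * (ε * E) := by
          rw [abs_mul, abs_mul, abs_of_nonneg hr, abs_of_pos (one_div_pos.2 hE0),
            abs_of_nonneg (hlow n)]
          gcongr
          exact hup n
        _ = ε * E := by ring
  have h2 : |E * (survival θ N n - (1 - 1 / E) ^ n)| ≤ E * (2 * ε) := by
    have e : E * (survival θ N n - (1 - 1 / E) ^ n) =
        (E * survival θ N n - killed θ N n (remaining θ N)) +
          (killed θ N n (remaining θ N) - E * (1 - 1 / E) ^ n) := by ring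
    rw [e]
    refine (abs_add_le _ _).trans ?_
    rw [abs_of_nonneg (hlow n)]
    linarith [hup n, hmain n]
  rw [abs_mul, abs_of_pos hE0] at h2
  exact le_of_mul_le_mul_left h2 hE0

lemma exists_abs_survival_sub_le (h0 : 0 < θ) (h : θ < 1 / 2) :
    ∃ C q : ℝ, 0 ≤ q ∧ q < 1 ∧ ∀ N, 0 < N → ∀ n,
      |survival θ N n - (1 - 1 / expectedTime θ N) ^ n| ≤ C * q ^ N := by
  have hβ := one_lt_ratio h0 h
  obtain ⟨a, ha1, haβ⟩ := exists_between hβ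
  have ha0 : 0 < a := by linarith
  -- As a function of `a`, the left side equals `1` exactly at `a = 1` and `a = β`, and is smaller
  -- in between.
  have hγ : θ * a + (1 - θ) / a < 1 := by
    rw [lt_div_iff₀ h0] at haβ
    have : θ * a + (1 - θ) / a - 1 = (a - 1) * (a * θ - (1 - θ)) / a := by field_simp; ring
    have : (a - 1) * (a * θ - (1 - θ)) / a < 0 :=
      div_neg_of_neg_of_pos (mul_neg_of_pos_of_neg (by linarith) (by linarith)) ha0
    linarith
  obtain ⟨C, hC, hsum⟩ := exists_sum_climb_le h0 h
  set β := (1 - θ) / θ with hβd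
  set K := 1 + a / (1 - (θ * a + (1 - θ) / a)) with hK
  refine ⟨2 * (C * β * K), a⁻¹, by positivity, inv_lt_one_of_one_lt₀ ha1, fun N hN n => ?_⟩
  have hE1 : 1 ≤ expectedTime θ N := one_le_expectedTime h0 (by linarith) hN
  rw [mul_assoc]
  refine abs_survival_sub_le h0 (by linarith) hN (fun n => ?_) n
  have hbound : ∀ k < N, expectedTime θ N - remaining θ N k ≤
      (C * β * a⁻¹ ^ N * expectedTime θ N) * a ^ k := by
    intro k hk
    -- Equivalent to `(β / a) ^ (N - k) ≥ 1`: trading `β` for the smaller base `a` gains the factor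
    -- `a⁻¹ ^ N`.
    have hpow : β ^ k ≤ β ^ N * (a⁻¹ ^ N * a ^ k) := by
      obtain ⟨m, rfl⟩ := Nat.exists_eq_add_of_lt hk
      clear_value β
      have e : β ^ (k + m + 1) * (a⁻¹ ^ (k + m + 1) * a ^ k) = β ^ k * (β / a) ^ (m + 1) := by
        simp only [div_pow, inv_pow, pow_add, pow_one]
        field_simp
      rw [e]
      refine le_mul_of_one_le_right (by positivity) (one_le_pow₀ ?_)
      rw [one_le_div ha0]; exact haβ.le
    calc expectedTime θ N - remaining θ N k ≤ C * β ^ k := by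
          simpa [remaining] using hsum k
      _ ≤ C * (β ^ N * (a⁻¹ ^ N * a ^ k)) := by gcongr
      _ ≤ C * ((β * expectedTime θ N) * (a⁻¹ ^ N * a ^ k)) := by
        gcongr; exact pow_le_expectedTime h0 (by linarith) hN
      _ = _ := by ring
  calc _ ≤ killed θ N n (fun k => (C * β * a⁻¹ ^ N * expectedTime θ N) * a ^ k) :=
        killed_mono h0.le (by linarith) n hbound
    _ = (C * β * a⁻¹ ^ N * expectedTime θ N) * killed θ N n (fun k => a ^ k) := killed_mul ..
    _ ≤ (C * β * a⁻¹ ^ N * expectedTime θ N) * K := by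
      gcongr
      exact killed_pow_le h0.le (by linarith) hN ha1.le hγ n
    _ = _ := by ring

lemma tendsto_one_sub_inv_pow_floor {t : ℝ} (ht : 0 ≤ t) :
    Tendsto (fun x : ℝ => (1 - 1 / x) ^ ⌊t * x⌋₊) atTop (𝓝 (Real.exp (-t))) := by
  have h1 := (tendsto_nat_floor_mul_div_atTop ht).mul
    (Real.tendsto_mul_log_one_add_div_atTop (-1))
  rw [mul_neg_one] at h1
  refine ((Real.continuous_exp.tendsto _).comp h1).congr' ?_
  filter_upwards [eventually_gt_atTop 1] with x hx
  have hx0 : 0 < x := by linarith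
  have h2 : 0 < 1 - 1 / x := by
    rw [sub_pos, div_lt_one hx0]; exact hx
  have e : (⌊t * x⌋₊ : ℝ) / x * (x * Real.log (1 + -1 / x)) =
      ⌊t * x⌋₊ * Real.log (1 - 1 / x) := by
    rw [neg_div, ← sub_eq_add_neg]; field_simp
  rw [Function.comp_apply, e, Real.exp_nat_mul, Real.exp_log h2]

/-- The rescaled survival probabilities converge to those of the exponential distribution. -/
lemma tendsto_survival_floor (h0 : 0 < θ) (h : θ < 1 / 2) {t : ℝ} (ht : 0 ≤ t) :
    Tendsto (fun N => survival θ N ⌊t * expectedTime θ N⌋₊) atTop (𝓝 (Real.exp (-t))) := by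
  obtain ⟨C, q, hq0, hq1, hC⟩ := exists_abs_survival_sub_le h0 h
  have h1 : Tendsto (fun N => survival θ N ⌊t * expectedTime θ N⌋₊ -
      (1 - 1 / expectedTime θ N) ^ ⌊t * expectedTime θ N⌋₊) atTop (𝓝 0) := by
    refine squeeze_zero_norm' (a := fun N => C * q ^ N) ?_
      (by simpa using (tendsto_pow_atTop_nhds_zero_of_lt_one hq0 hq1).const_mul C)
    filter_upwards [eventually_gt_atTop 0] with N hN
    exact hC N hN _
  simpa using h1.add
    ((tendsto_one_sub_inv_pow_floor ht).comp (tendsto_expectedTime_atTop h0 h))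

/-! ### Outward drift: exponential tail bounds -/

/-- Here `β < 1`, so `climb θ k` converges to `1 / (2θ - 1)`, and `E / N` is its Cesàro mean. -/
lemma tendsto_expectedTime_div (h : 1 / 2 < θ) (h1 : θ ≤ 1) :
    Tendsto (fun N : ℕ => (N : ℝ)⁻¹ * expectedTime θ N) atTop (𝓝 (1 / (2 * θ - 1))) := by
  have h0 : 0 < θ := by linarith
  refine Filter.Tendsto.cesaro ?_
  have hβ : (1 - θ) / θ < 1 := by rw [div_lt_one h0]; linarith
  have h2 := ((tendsto_pow_atTop_nhds_zero_of_lt_one (div_nonneg (by linarith) h0.le) hβ).mul_const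
    (1 + 1 / (1 - 2 * θ))).sub_const (1 / (1 - 2 * θ))
  rw [zero_mul, zero_sub, ← div_neg, neg_sub] at h2
  exact h2.congr fun k => (climb_add_eq h0 (by linarith) k).symm

lemma exp_mean_le (h0 : 0 ≤ θ) (h1 : θ ≤ 1) {s : ℝ} (hs : |s| ≤ 1) :
    θ * Real.exp s + (1 - θ) * Real.exp (-s) ≤ Real.exp (s * (2 * θ - 1) + s ^ 2) := by
  have e1 := (abs_le.1 (Real.abs_exp_sub_one_sub_id_le hs)).2
  have e2 := (abs_le.1 (Real.abs_exp_sub_one_sub_id_le (x := -s) (by rwa [abs_neg]))).2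
  have e3 := mul_le_mul_of_nonneg_left e1 h0
  have e4 := mul_le_mul_of_nonneg_left e2 (sub_nonneg.2 h1)
  have e5 := Real.add_one_le_exp (s * (2 * θ - 1) + s ^ 2)
  linarith

/-- Chernoff bound with test function `exp (-s k)`, which shrinks by the factor `m` per step;
reflection at `0` only helps. While the walk survives, this function is at least `exp (-s N)`. -/
lemma survival_le_exp (h0 : 0 ≤ θ) (h1 : θ ≤ 1) (hN : 0 < N) {s : ℝ} (hs0 : 0 ≤ s) (hs : s ≤ 1)
    (n : ℕ) : survival θ N n ≤ Real.exp (n * (-(s * (2 * θ - 1)) + s ^ 2) + s * N) := by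
  set m := θ * Real.exp (-s) + (1 - θ) * Real.exp s with hm
  have hm0 : 0 ≤ m := add_nonneg (by positivity) (mul_nonneg (by linarith) (Real.exp_nonneg _))
  have hme : m ≤ Real.exp (-(s * (2 * θ - 1)) + s ^ 2) := by
    have := exp_mean_le h0 h1 (s := -s) (by rwa [abs_neg, abs_of_nonneg hs0])
    rwa [neg_neg, neg_sq, neg_mul] at this
  have hstep : ∀ k, foldStep θ (fun k => Real.exp (-s) ^ k) k ≤ m * Real.exp (-s) ^ k := by
    intro k
    cases k with
    | zero =>
      have : Real.exp (-s) ≤ Real.exp s := Real.exp_le_exp.2 (by linarith)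
      have := mul_le_mul_of_nonneg_left this (sub_nonneg.2 h1)
      simp only [foldStep, pow_one, pow_zero, mul_one]
      linarith
    | succ k =>
      have : Real.exp s * Real.exp (-s) = 1 := by rw [← Real.exp_add]; simp
      refine le_of_eq ?_
      simp only [foldStep]
      rw [hm, pow_succ, pow_succ]
      linear_combination (-(1 - θ)) * Real.exp (-s) ^ k * this
  have hk : ∀ n, killed θ N n (fun k => Real.exp (-s) ^ k) ≤ m ^ n := by
    intro n
    induction n with
    | zero => simp [killed_zero hN]
    | succ n ih =>
      calc _ ≤ killed θ N n (foldStep θ fun k => Real.exp (-s) ^ k) :=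
            killed_succ_le h0 h1 hN n (by positivity)
        _ ≤ killed θ N n (fun k => m * Real.exp (-s) ^ k) := killed_mono h0 h1 n fun k _ => hstep k
        _ = m * killed θ N n (fun k => Real.exp (-s) ^ k) := killed_mul ..
        _ ≤ m * m ^ n := by gcongr
        _ = m ^ (n + 1) := (pow_succ' m n).symm
  have hlow : Real.exp (-s) ^ N * survival θ N n ≤ m ^ n := by
    rw [← killed_const]
    refine (killed_mono h0 h1 n fun k hk => ?_).trans (hk n)
    exact pow_le_pow_of_le_one (Real.exp_nonneg _) (Real.exp_le_one_iff.2 (by linarith)) hk.le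
  rw [← Real.exp_nat_mul] at hlow
  calc survival θ N n = Real.exp (s * N) * (Real.exp (N * -s) * survival θ N n) := by
        rw [← mul_assoc, ← Real.exp_add]; ring_nf; simp
    _ ≤ Real.exp (s * N) * m ^ n := by gcongr
    _ ≤ Real.exp (s * N) * Real.exp (-(s * (2 * θ - 1)) + s ^ 2) ^ n := by gcongr
    _ = _ := by rw [← Real.exp_nat_mul, ← Real.exp_add]; ring_nf

/-- Chernoff bound with `exp (s k)`. Reflection at `0` now hurts, so `C * β ^ k` is added: it is
harmonic away from `0`, and its drop `C (1 - β) = exp 1` from `0` to `1` pays for `exp s`. -/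
lemma one_sub_survival_le_exp (h : 1 / 2 < θ) (h1 : θ ≤ 1) :
    ∃ C : ℝ, 0 ≤ C ∧ ∀ N, 0 < N → ∀ s, 0 ≤ s → s ≤ 1 → ∀ n : ℕ,
      1 - survival θ N n ≤ C * Real.exp (n * (s * (2 * θ - 1) + s ^ 2) - s * N) := by
  have h0 : 0 < θ := by linarith
  have hβ : (1 - θ) / θ < 1 := by rw [div_lt_one h0]; linarith
  have hβ0 : 0 ≤ (1 - θ) / θ := div_nonneg (by linarith) h0.le
  have hβθ : θ * ((1 - θ) / θ) = 1 - θ := by field_simp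
  set β := (1 - θ) / θ with hβd
  have hβ1 : 0 < 1 - β := by linarith
  set C := Real.exp 1 / (1 - β) with hC
  have hC0 : 0 < C := by positivity
  refine ⟨1 + C, by positivity, fun N hN s hs0 hs n => ?_⟩
  set m := θ * Real.exp s + (1 - θ) * Real.exp (-s) with hm
  have hme : m ≤ Real.exp (s * (2 * θ - 1) + s ^ 2) :=
    exp_mean_le h0.le h1 (by rwa [abs_of_nonneg hs0])
  have hm1 : 1 ≤ m := by
    have e1 := mul_le_mul_of_nonneg_left (Real.add_one_le_exp s) h0.le
    have e2 := mul_le_mul_of_nonneg_left (Real.add_one_le_exp (-s)) (sub_nonneg.2 h1)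
    have e3 : 0 ≤ s * (2 * θ - 1) := mul_nonneg hs0 (by linarith)
    linarith
  set V : ℕ → ℝ := fun k => Real.exp s ^ k + C * β ^ k with hV
  have hstep : ∀ k, foldStep θ V k ≤ m * V k := by
    intro k
    cases k with
    | zero =>
      have e1 : Real.exp s ≤ Real.exp 1 := Real.exp_le_exp.2 hs
      have e2 : C * (1 - β) = Real.exp 1 := by rw [hC]; field_simp
      simp only [foldStep, hV, pow_one, pow_zero, mul_one]
      nlinarith
    | succ k =>
      have e : Real.exp s * Real.exp (-s) = 1 := by rw [← Real.exp_add]; simp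
      have e1 : θ * Real.exp s ^ (k + 2) + (1 - θ) * Real.exp s ^ k = m * Real.exp s ^ (k + 1) := by
        rw [hm, pow_succ, pow_succ]
        linear_combination (-(1 - θ)) * Real.exp s ^ k * e
      have e2 : θ * β ^ (k + 2) + (1 - θ) * β ^ k = β ^ (k + 1) := by
        rw [pow_succ, pow_succ, ← hβθ]
        linear_combination β ^ k * β * hβθ
      have e3 : C * β ^ (k + 1) ≤ m * (C * β ^ (k + 1)) :=
        le_mul_of_one_le_left (by positivity) hm1
      simp only [foldStep, hV]
      linear_combination e1 + C * e2 + e3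
  have hVN : 0 ≤ V N := by positivity
  -- The left side is the mean of `V` along the walk stopped at `±N`. As `m ≥ 1`, the absorbed part
  -- also grows at most by the factor `m`.
  have hk : ∀ n, killed θ N n V + V N * (1 - survival θ N n) ≤ m ^ n * (1 + C) := by
    intro n
    induction n with
    | zero => simp [killed_zero hN, survival_zero hN, hV]
    | succ n ih =>
      have e1 := killed_foldStep (θ := θ) hN n V
      have e2 : killed θ N n (foldStep θ V) ≤ m * killed θ N n V := by
        rw [← killed_mul]; exact killed_mono h0.le h1 n fun k _ => hstep k
      have e3 : V N * (1 - survival θ N n) ≤ m * (V N * (1 - survival θ N n)) :=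
        le_mul_of_one_le_left
          (mul_nonneg hVN (sub_nonneg.2 (survival_le_one h0.le h1 hN n))) hm1
      have e4 := mul_le_mul_of_nonneg_left ih (by linarith : 0 ≤ m)
      rw [pow_succ]
      linarith
  have hnn : 0 ≤ 1 - survival θ N n := sub_nonneg.2 (survival_le_one h0.le h1 hN n)
  have hlow : Real.exp (N * s) * (1 - survival θ N n) ≤ m ^ n * (1 + C) := by
    have e1 : 0 ≤ killed θ N n V := killed_nonneg h0.le h1 n fun k _ => by positivity
    have e2 : Real.exp (N * s) ≤ V N := by
      rw [Real.exp_nat_mul]; exact le_add_of_nonneg_right (by positivity)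
    linarith [hk n, mul_le_mul_of_nonneg_right e2 hnn]
  calc 1 - survival θ N n = Real.exp (-(s * N)) * (Real.exp (N * s) * (1 - survival θ N n)) := by
        rw [← mul_assoc, ← Real.exp_add, show -(s * N) + N * s = 0 by ring, Real.exp_zero, one_mul]
    _ ≤ Real.exp (-(s * N)) * (m ^ n * (1 + C)) := by gcongr
    _ ≤ Real.exp (-(s * N)) * (Real.exp (s * (2 * θ - 1) + s ^ 2) ^ n * (1 + C)) := by gcongr
    _ = _ := by
      rw [← Real.exp_nat_mul, Real.exp_sub, Real.exp_neg]; ring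

/-- The walk with outward drift is unlikely to need much more time than `N / (2θ - 1)`. -/
lemma exists_survival_le_pow (h : 1 / 2 < θ) (h1 : θ ≤ 1) {ε : ℝ} (hε : 0 < ε) :
    ∃ q : ℝ, 0 ≤ q ∧ q < 1 ∧ ∀ N : ℕ, 0 < N → ∀ n : ℕ, (1 + ε) * N / (2 * θ - 1) ≤ n →
      survival θ N n ≤ q ^ N := by
  set μ := 2 * θ - 1 with hμ
  have hμ0 : 0 < μ := by linarith
  have hμ1 : μ ≤ 1 := by linarith
  -- This minimises the exponent at `n = (1 + ε) N / μ`; as `s < μ`, the exponent decreases in `n`,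
  -- so larger `n` are no worse.
  set s := μ * ε / (2 * (1 + ε)) with hs
  have hs0 : 0 < s := by positivity
  have hsμ : s < μ := by
    rw [hs, div_lt_iff₀ (by positivity)]; nlinarith
  refine ⟨Real.exp (-(s * ε / 2)), (Real.exp_pos _).le, Real.exp_lt_one_iff.2 (by
    have : 0 < s * ε := by positivity
    linarith), fun N hN n hn => ?_⟩
  refine (survival_le_exp (by linarith) h1 hN hs0.le (by linarith) n).trans ?_
  rw [← Real.exp_nat_mul, Real.exp_le_exp]
  have e1 : (n : ℝ) * (-(s * μ) + s ^ 2) ≤ (1 + ε) * N / μ * (-(s * μ) + s ^ 2) :=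
    mul_le_mul_of_nonpos_right hn (by nlinarith)
  have e2 : (1 + ε) * N / μ * (-(s * μ) + s ^ 2) + s * N = N * -(s * ε / 2) := by
    rw [hs]; field_simp; ring
  linarith

/-- The walk with outward drift is unlikely to need much less time than `N / (2θ - 1)`. -/
lemma exists_one_sub_survival_le_pow (h : 1 / 2 < θ) (h1 : θ ≤ 1) {ε : ℝ} (hε : 0 < ε)
    (hε1 : ε ≤ 1) :
    ∃ C q : ℝ, 0 ≤ q ∧ q < 1 ∧ ∀ N : ℕ, 0 < N → ∀ n : ℕ, n ≤ (1 - ε) * N / (2 * θ - 1) →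
      1 - survival θ N n ≤ C * q ^ N := by
  obtain ⟨C, hC, hb⟩ := one_sub_survival_le_exp h h1
  set μ := 2 * θ - 1 with hμ
  have hμ0 : 0 < μ := by linarith
  have hμ1 : μ ≤ 1 := by linarith
  -- The exact minimiser has `1 - ε` in the denominator; dropping it keeps `s ≤ 1` up to `ε = 1` and
  -- still leaves `-(s * ε / 2)`.
  set s := μ * ε / 2 with hs
  have hs0 : 0 < s := by positivity
  have hs1 : s ≤ 1 := by rw [hs]; nlinarith
  refine ⟨C, Real.exp (-(s * ε / 2)), (Real.exp_pos _).le, Real.exp_lt_one_iff.2 (by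
    have : 0 < s * ε := by positivity
    linarith), fun N hN n hn => (hb N hN s hs0.le hs1 n).trans ?_⟩
  refine mul_le_mul_of_nonneg_left ?_ hC
  rw [← Real.exp_nat_mul, Real.exp_le_exp]
  have e1 : (n : ℝ) * (s * μ + s ^ 2) ≤ (1 - ε) * N / μ * (s * μ + s ^ 2) :=
    mul_le_mul_of_nonneg_right hn (by positivity)
  have e2 : (1 - ε) * N / μ * (s * μ + s ^ 2) - s * N = N * -(s * ε / 2) - N * s * ε ^ 2 / 2 := by
    rw [hs]; field_simp; ring
  have e3 : 0 ≤ N * s * ε ^ 2 / 2 := by positivity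
  linarith

end SingleWell

/-! ### From the Markov chain to the survival probabilities -/

namespace SingleWell

variable {Ω : Type*} [MeasurableSpace Ω] {P : Measure Ω}
  {θ : ℝ} {N : ℕ} {X : ℕ → Ω → ℤ} {Q : ℤ → ℤ → ℝ} {x₀ : ℤ}

lemma measurableSet_forall_eq (hX : ∀ n, Measurable (X n)) (n : ℕ) (s : ℕ → ℤ) :
    MeasurableSet {ω | ∀ k ≤ n, X k ω = s k} := by
  simp only [Set.ofPred_forall]
  exact MeasurableSet.iInter fun k => MeasurableSet.iInter fun _ =>
    hX k (measurableSet_singleton (s k))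

/-- The path which follows `p` before time `n`, is at `x` at time `n` and then at `y`. -/
def extendPath {n : ℕ} (p : Fin n → ℤ) (x y : ℤ) (k : ℕ) : ℤ :=
  if h : k < n then p ⟨k, h⟩ else if k = n then x else y

lemma extendPath_of_lt {n : ℕ} (p : Fin n → ℤ) (x y : ℤ) {k : ℕ} (h : k < n) :
    extendPath p x y k = p ⟨k, h⟩ := by simp [extendPath, h]

lemma extendPath_self {n : ℕ} (p : Fin n → ℤ) (x y : ℤ) : extendPath p x y n = x := by
  simp [extendPath]

lemma extendPath_succ {n : ℕ} (p : Fin n → ℤ) (x y : ℤ) : extendPath p x y (n + 1) = y := by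
  simp [extendPath]

lemma lt_hitTime_iff {Ω : Type*} {X : ℕ → Ω → ℤ} {n : ℕ} {ω : Ω} :
    (n : ℕ∞) < hitTime N X ω ↔ ∀ k ≤ n, X k ω ≠ -(N : ℤ) ∧ X k ω ≠ N := by
  rw [← not_le]
  change ¬ hittingAfter X _ 0 ω ≤ WithTop.some n ↔ _
  rw [hittingAfter_le_iff]
  simp [not_or]

lemma measurableSet_lt_hitTime (hX : ∀ n, Measurable (X n)) (n : ℕ) :
    MeasurableSet {ω | (n : ℕ∞) < hitTime N X ω} := by
  simp only [lt_hitTime_iff, Set.ofPred_forall]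
  refine MeasurableSet.iInter fun k => MeasurableSet.iInter fun _ => MeasurableSet.inter ?_ ?_
  · exact (hX k (measurableSet_singleton _)).compl
  · exact (hX k (measurableSet_singleton _)).compl

lemma IsWalk.measurable (hW : IsWalk P θ N X) (n : ℕ) : Measurable (X n) := by
  obtain ⟨Q, -, -, hX⟩ := hW
  exact hX.measurable n

/-- Integrated, this is the tail-sum formula `E[τ] = ∑ P(τ > n)`, valid also when `τ = ⊤`. -/
lemma toENNReal_eq_tsum (a : ℕ∞) : (a : ℝ≥0∞) = ∑' n : ℕ, if (n : ℕ∞) < a then 1 else 0 := by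
  induction a using ENat.recTopCoe with
  | top =>
    simp only [ENat.natCast_lt_top, if_true, ENat.toENNReal_top]
    exact (ENNReal.tsum_const_eq_top_of_ne_zero one_ne_zero).symm
  | coe m =>
    rw [tsum_eq_sum (s := Finset.range m)]
    · rw [Finset.sum_congr rfl fun n hn => if_pos (by simpa using hn)]
      simp
    · intro n hn
      rw [if_neg (by simpa using hn)]

lemma measurable_hitTime (hX : ∀ n, Measurable (X n)) :
    Measurable fun ω => (hitTime N X ω : ℝ≥0∞) := by
  simp only [toENNReal_eq_tsum]
  exact Measurable.tsum fun n =>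
    Measurable.ite (measurableSet_lt_hitTime hX n) measurable_const measurable_const

lemma measurable_normalized (hX : ∀ n, Measurable (X n)) :
    Measurable (normalized P (hitTime N X)) :=
  ((measurable_hitTime hX).div_const _).ennreal_toReal

variable [IsProbabilityMeasure P]

/-- An event is decomposed according to the path of the process before time `n`. -/
lemma sum_measureReal_extendPath (hX : ∀ n, Measurable (X n)) (B : Finset ℤ) (n m : ℕ)
    (hm : n ≤ m) (x y : ℤ) :
    P.real {ω | (∀ k < n, X k ω ∈ B) ∧ ∀ k ≤ m, n ≤ k → X k ω = if k = n then x else y} =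
      ∑ p ∈ Fintype.piFinset fun _ : Fin n => B,
        P.real {ω | ∀ k ≤ m, X k ω = extendPath p x y k} := by
  rw [← measureReal_biUnion_finset]
  · congr 1
    ext ω
    simp only [Set.mem_ofPred_eq, Set.mem_iUnion, Fintype.mem_piFinset, exists_prop]
    constructor
    · rintro ⟨h1, h2⟩
      refine ⟨fun k => X k ω, fun k => h1 k k.2, fun k hk => ?_⟩
      by_cases hkn : k < n
      · rw [extendPath_of_lt _ _ _ hkn]
      · rw [h2 k hk (not_lt.1 hkn), extendPath, dif_neg hkn]
    · rintro ⟨p, hp, h⟩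
      refine ⟨fun k hk => ?_, fun k hk hnk => ?_⟩
      · rw [h k (by omega), extendPath_of_lt _ _ _ hk]; exact hp _
      · rw [h k hk, extendPath, dif_neg (not_lt.2 hnk)]
  · intro p _ p' _ hpp
    refine Set.disjoint_left.2 fun ω h h' => hpp (funext fun k => ?_)
    have h1 := h k (by omega)
    have h2 := h' k (by omega)
    rw [extendPath_of_lt _ _ _ k.2] at h1 h2
    exact h1.symm.trans h2
  · exact fun p _ => measurableSet_forall_eq hX m _

/-- The Markov property, given that the process stays in a finite set. -/
lemma measureReal_step (hX : IsMarkovChain P Q x₀ X) (B : Finset ℤ) (n : ℕ) (x y : ℤ) :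
    P.real {ω | (∀ k < n, X k ω ∈ B) ∧ X n ω = x ∧ X (n + 1) ω = y} =
      P.real {ω | (∀ k < n, X k ω ∈ B) ∧ X n ω = x} * Q x y := by
  have h1 := sum_measureReal_extendPath (P := P) hX.measurable B n (n + 1) (by omega) x y
  have h2 := sum_measureReal_extendPath (P := P) hX.measurable B n n le_rfl x y
  have e1 : {ω | (∀ k < n, X k ω ∈ B) ∧ X n ω = x ∧ X (n + 1) ω = y} =
      {ω | (∀ k < n, X k ω ∈ B) ∧ ∀ k ≤ n + 1, n ≤ k → X k ω = if k = n then x else y} := by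
    ext ω
    refine and_congr_right fun _ => ⟨?_, fun h => ?_⟩
    · rintro ⟨hx, hy⟩ k hk hnk
      obtain rfl | rfl : k = n ∨ k = n + 1 := by omega
      · simpa using hx
      · simpa using hy
    · exact ⟨by simpa using h n (by omega) le_rfl, by simpa using h (n + 1) le_rfl (by omega)⟩
  have e2 : {ω | (∀ k < n, X k ω ∈ B) ∧ X n ω = x} =
      {ω | (∀ k < n, X k ω ∈ B) ∧ ∀ k ≤ n, n ≤ k → X k ω = if k = n then x else y} := by
    ext ω
    refine and_congr_right fun _ => ⟨fun hx k hk hnk => ?_, fun h => ?_⟩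
    · obtain rfl : k = n := by omega
      simpa using hx
    · simpa using h n le_rfl le_rfl
  rw [e1, e2, h1, h2, Finset.sum_mul]
  refine Finset.sum_congr rfl fun p _ => ?_
  rw [hX.step, extendPath_self, extendPath_succ]

lemma measureReal_split (hX : ∀ n, Measurable (X n)) (B : Finset ℤ) (n : ℕ) {A : Set Ω}
    (hA : MeasurableSet A) :
    P.real ({ω | ∀ k < n + 1, X k ω ∈ B} ∩ A) =
      ∑ x ∈ B, P.real ({ω | (∀ k < n, X k ω ∈ B) ∧ X n ω = x} ∩ A) := by
  rw [← measureReal_biUnion_finset]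
  · congr 1
    ext ω
    simp only [Set.mem_inter_iff, Set.mem_ofPred_eq, Set.mem_iUnion, exists_prop,
      Nat.forall_lt_succ_right]
    grind
  · intro x _ x' _ hxx
    exact Set.disjoint_left.2 fun ω h h' => hxx (h.1.2.symm.trans h'.1.2)
  · refine fun x _ => MeasurableSet.inter
      (MeasurableSet.inter (s₁ := {ω | ∀ k < n, X k ω ∈ B}) ?_ ?_) hA
    · simp only [Set.ofPred_forall]
      exact MeasurableSet.iInter fun k => MeasurableSet.iInter fun _ => hX k B.measurableSet
    · exact hX n (measurableSet_singleton x)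

/-- `occupation` describes the law of the walk before it leaves `(-N, N)`. -/
lemma IsWalk.measureReal_eq_occupation (hW : IsWalk P θ N X) (n : ℕ) (x : ℤ) :
    P.real {ω | (∀ k < n, X k ω ∈ Finset.Ioo (-(N : ℤ)) N) ∧ X n ω = x} = occupation θ N n x := by
  obtain ⟨Q, -, hQ, hX⟩ := hW
  induction n generalizing x with
  | zero =>
    simp only [Nat.not_lt_zero, false_imp_iff, implies_true, true_and, occupation]
    split_ifs with h
    · subst h
      rw [measureReal_congr (t := Set.univ) (eventuallyEq_univ.2 hX.start), probReal_univ]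
    · rw [measureReal_def, measure_mono_null (t := {ω | ¬ X 0 ω = 0}) _ hX.start]
      · simp
      · rintro ω rfl; exact h
  | succ n ih =>
    have h := measureReal_split (P := P) hX.measurable (Finset.Ioo (-(N : ℤ)) N) n
      (hX.measurable (n + 1) (measurableSet_singleton x))
    refine Eq.trans ?_ (h.trans ?_)
    · rfl
    · refine Finset.sum_congr rfl fun y hy => ?_
      rw [← ih, ← hQ y (Finset.mem_Ioo.1 hy).1 (Finset.mem_Ioo.1 hy).2,
        ← measureReal_step hX]
      congr 1
      ext ω
      exact and_assoc

lemma occupation_eq_zero (hN : 0 < N) (n : ℕ) {x : ℤ} (hx : N < x.natAbs) :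
    occupation θ N n x = 0 := by
  cases n with
  | zero => rw [occupation, if_neg (by omega)]
  | succ n =>
    refine Finset.sum_eq_zero fun y hy => ?_
    rw [Finset.mem_Ioo] at hy
    rw [transition_eq, if_neg (by omega), if_neg (by omega)]
    ring

/-- Not hitting `±N` means staying strictly between them only because the walk cannot jump over
them. Paths that do so form a countable union, over times and positions, of null events. -/
lemma IsWalk.ae_lt_hitTime_iff (hW : IsWalk P θ N X) (hN : 0 < N) :
    ∀ᵐ ω ∂P, ∀ n : ℕ, (n : ℕ∞) < hitTime N X ω ↔
      ∀ k < n + 1, X k ω ∈ Finset.Ioo (-(N : ℤ)) N := by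
  have h : ∀ᵐ ω ∂P, ∀ (n : ℕ) (x : ℤ), N < x.natAbs →
      ¬ ((∀ k < n, X k ω ∈ Finset.Ioo (-(N : ℤ)) N) ∧ X n ω = x) := by
    rw [ae_all_iff]; intro n
    rw [ae_all_iff]; intro x
    by_cases hx : N < x.natAbs
    · have h0 := hW.measureReal_eq_occupation n x
      rw [occupation_eq_zero hN n hx, measureReal_eq_zero_iff] at h0
      filter_upwards [measure_eq_zero_iff_ae_notMem.1 h0] with ω hω _ using hω
    · exact ae_of_all _ fun ω h => absurd h hx
  filter_upwards [h] with ω hω n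
  rw [lt_hitTime_iff]
  refine ⟨fun h k => ?_, fun h k hk => ?_⟩
  · induction k using Nat.strong_induction_on with
    | _ k ih =>
      intro hk
      have h1 := h k (by omega)
      have h2 : ¬ N < (X k ω).natAbs := fun h3 =>
        hω k _ h3 ⟨fun j hj => ih j hj (by omega), rfl⟩
      rw [Finset.mem_Ioo]; omega
  · have := Finset.mem_Ioo.1 (h k (by omega))
    omega

lemma IsWalk.measureReal_lt_hitTime (hW : IsWalk P θ N X) (hN : 0 < N) (n : ℕ) :
    P.real {ω | (n : ℕ∞) < hitTime N X ω} = survival θ N n := by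
  have h1 : P.real {ω | (n : ℕ∞) < hitTime N X ω} =
      P.real ({ω | ∀ k < n + 1, X k ω ∈ Finset.Ioo (-(N : ℤ)) N} ∩ Set.univ) := by
    refine measureReal_congr ?_
    filter_upwards [hW.ae_lt_hitTime_iff hN] with ω hω
    rw [Set.inter_univ]
    exact propext (hω n)
  rw [h1, measureReal_split hW.measurable _ _ MeasurableSet.univ, survival, killed]
  refine Finset.sum_congr rfl fun x _ => ?_
  rw [Set.inter_univ, hW.measureReal_eq_occupation, mul_one]

lemma IsWalk.mean_eq (hW : IsWalk P θ N X) (hN : 0 < N) (h0 : 0 < θ) (h1 : θ ≤ 1) :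
    mean P (hitTime N X) = ENNReal.ofReal (expectedTime θ N) := by
  simp only [mean, toENNReal_eq_tsum]
  rw [lintegral_tsum fun n => (Measurable.ite (measurableSet_lt_hitTime hW.measurable n)
    measurable_const measurable_const).aemeasurable]
  have hs := hasSum_survival h0 h1 hN
  rw [← hs.tsum_eq, ENNReal.ofReal_tsum_of_nonneg (survival_nonneg h0.le h1) hs.summable]
  refine tsum_congr fun n => ?_
  rw [← hW.measureReal_lt_hitTime hN, ofReal_measureReal,
    ← lintegral_indicator_one (measurableSet_lt_hitTime hW.measurable n)]
  simp only [Set.indicator_apply, Set.mem_ofPred_eq, Pi.one_apply]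

lemma IsWalk.mean_pos_lt_top (hW : IsWalk P θ N X) (hN : 0 < N) (h0 : 0 < θ) (h1 : θ ≤ 1) :
    0 < mean P (hitTime N X) ∧ mean P (hitTime N X) < ∞ := by
  rw [hW.mean_eq hN h0 h1]
  exact ⟨ENNReal.ofReal_pos.2 (zero_lt_one.trans_le (one_le_expectedTime h0 h1 hN)),
    ENNReal.ofReal_lt_top⟩

lemma IsWalk.ae_normalized_eq (hW : IsWalk P θ N X) (hN : 0 < N) (h0 : 0 < θ) (h1 : θ ≤ 1) :
    ∀ᵐ ω ∂P, ∃ m : ℕ, hitTime N X ω = m ∧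
      normalized P (hitTime N X) ω = m / expectedTime θ N := by
  have hE := one_le_expectedTime h0 h1 hN
  have hfin := ae_lt_top (measurable_hitTime (N := N) hW.measurable)
    (hW.mean_pos_lt_top hN h0 h1).2.ne
  filter_upwards [hfin] with ω hω
  obtain ⟨m, hm⟩ := ENat.ne_top_iff_exists.1 (ENat.toENNReal_lt_top.1 hω).ne
  refine ⟨m, hm.symm, ?_⟩
  rw [normalized, hW.mean_eq hN h0 h1, ← hm, ENNReal.toReal_div,
    ENNReal.toReal_ofReal (by linarith)]
  simp

/-- Since `τ` is almost surely an integer, `τ > t * E` is the same as `τ > ⌊t * E⌋₊`. -/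
lemma IsWalk.measureReal_lt_normalized (hW : IsWalk P θ N X) (hN : 0 < N) (h0 : 0 < θ)
    (h1 : θ ≤ 1) {t : ℝ} (ht : 0 ≤ t) :
    P.real {ω | t < normalized P (hitTime N X) ω} = survival θ N ⌊t * expectedTime θ N⌋₊ := by
  rw [← hW.measureReal_lt_hitTime hN]
  have hE := one_le_expectedTime h0 h1 hN
  refine measureReal_congr ?_
  filter_upwards [hW.ae_normalized_eq hN h0 h1] with ω hω
  obtain ⟨m, hm, hn⟩ := hω
  refine propext ?_
  change t < normalized P (hitTime N X) ω ↔ (_ : ℕ∞) < hitTime N X ω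
  rw [hm, hn, lt_div_iff₀ (by linarith), Nat.cast_lt, Nat.floor_lt (by positivity)]

end SingleWell

/-! ### Convergence in distribution, almost sure convergence and cut-off -/

namespace SingleWell

/-- Convergence of the distribution functions at every point implies weak convergence. -/
lemma tendsto_probabilityMeasure_of_tendsto_Iic {ι : Type*} {l : Filter ι} [l.IsCountablyGenerated]
    {μ : ι → ProbabilityMeasure ℝ} {ν : ProbabilityMeasure ℝ}
    (h : ∀ t, Tendsto (fun i => (μ i : Measure ℝ).real (Set.Iic t)) l
      (𝓝 ((ν : Measure ℝ).real (Set.Iic t)))) : Tendsto μ l (𝓝 ν) := by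
  have hIoc : ∀ (m : ProbabilityMeasure ℝ) {a b : ℝ}, a < b →
      ((m (Set.Ioc a b) : NNReal) : ℝ) =
        (m : Measure ℝ).real (Set.Iic b) - (m : Measure ℝ).real (Set.Iic a) := by
    intro m a b hab
    rw [show Set.Ioc a b = Set.Iic b \ Set.Iic a by ext x; simp [and_comm],
      ← measureReal_sdiff (Set.Iic_subset_Iic.2 hab.le) measurableSet_Iic]
    rfl
  -- Half-open intervals form a π-system containing arbitrarily small neighbourhoods of each point,
  -- and their masses are differences of distribution functions.
  refine (isPiSystem_Ioc_mem Set.univ Set.univ).tendsto_probabilityMeasure_of_tendsto_of_mem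
    ?_ ?_ ?_
  · rintro s ⟨a, -, b, -, -, rfl⟩
    exact measurableSet_Ioc
  · intro u hu x hx
    obtain ⟨δ, hδ, hb⟩ := Metric.isOpen_iff.1 hu x hx
    refine ⟨Set.Ioc (x - δ / 2) (x + δ / 2),
      ⟨_, trivial, _, trivial, by linarith, rfl⟩, Ioc_mem_nhds (by linarith) (by linarith), ?_⟩
    refine fun y hy => hb ?_
    rw [Metric.mem_ball, Real.dist_eq, abs_lt]
    exact ⟨by linarith [hy.1], by linarith [hy.2]⟩
  · rintro s ⟨a, -, b, -, hab, rfl⟩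
    rw [← NNReal.tendsto_coe]
    simp only [hIoc _ hab]
    exact (h b).sub (h a)

/-- A process of nonnegative random variables whose tails converge to `exp (-t)` converges in
distribution to an exponential random variable. -/
lemma tendstoInDistribution_exp {ι : Type*} {l : Filter ι} [l.IsCountablyGenerated]
    {Ω : ι → Type*} [∀ i, MeasurableSpace (Ω i)] {P : ∀ i, Measure (Ω i)}
    [∀ i, IsProbabilityMeasure (P i)] {Y : ∀ i, Ω i → ℝ} (hY : ∀ i, Measurable (Y i))
    (hY0 : ∀ i ω, 0 ≤ Y i ω)
    (h : ∀ t, 0 ≤ t → Tendsto (fun i => (P i).real {ω | t < Y i ω}) l (𝓝 (Real.exp (-t)))) :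
    TendstoInDistribution Y l (id : ℝ → ℝ) P (expMeasure 1) := by
  refine ⟨fun i => (hY i).aemeasurable, aemeasurable_id,
    tendsto_probabilityMeasure_of_tendsto_Iic fun t => ?_⟩
  simp only [ProbabilityMeasure.coe_mk, Measure.map_id]
  rw [← cdf_eq_real, cdf_expMeasure_eq one_pos, one_mul]
  have hmap : ∀ i, ((P i).map (Y i)).real (Set.Iic t) = (P i).real {ω | Y i ω ≤ t} := fun i =>
    map_measureReal_apply (hY i) measurableSet_Iic
  simp only [hmap]
  split_ifs with ht
  · refine (tendsto_const_nhds.sub (h t ht)).congr fun i => ?_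
    refine (probReal_compl_eq_one_sub (μ := P i) (hY i (measurableSet_Ioi (a := t)))).symm.trans ?_
    congr 1
    ext ω
    exact (not_lt : ¬ t < Y i ω ↔ Y i ω ≤ t)
  -- For `t < 0` both distribution functions vanish, by nonnegativity of `Y`.
  · refine tendsto_const_nhds.congr fun i => ?_
    rw [show {ω | Y i ω ≤ t} = ∅ from Set.eq_empty_of_forall_notMem fun ω hω =>
      ht ((hY0 i ω).trans hω), measureReal_empty]

section Metastability

variable {Ω : ℕ+ → Type*} [∀ N, MeasurableSpace (Ω N)] {P : ∀ N, Measure (Ω N)}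
  [∀ N, IsProbabilityMeasure (P N)] {X : ∀ N, ℕ → Ω N → ℤ} {θ : ℝ}

lemma metastable_hitTime (hW : ∀ N : ℕ+, IsWalk (P N) θ N (X N)) (h0 : 0 < θ) (h : θ < 1 / 2) :
    Metastable P (fun N : ℕ+ => hitTime N (X N)) := by
  intro t ht
  refine ((tendsto_survival_floor h0 h ht).comp tendsto_PNat_val_atTop_atTop).congr fun N => ?_
  exact ((hW N).measureReal_lt_normalized N.pos h0 (by linarith) ht).symm

end Metastability

section CutOff

variable {Ω : Type*} [MeasurableSpace Ω] {P : Measure Ω} [IsProbabilityMeasure P]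
  {X : ℕ+ → ℕ → Ω → ℤ} {θ : ℝ}

lemma ae_eventually_notMem_of_le_pow {s : ℕ+ → Set Ω} {C q : ℝ} (hq0 : 0 ≤ q) (hq1 : q < 1)
    (h : ∀ N, P.real (s N) ≤ C * q ^ (N : ℕ)) : ∀ᵐ ω ∂P, ∀ᶠ N in atTop, ω ∉ s N := by
  have hs : Summable fun N : ℕ+ => C * q ^ (N : ℕ) :=
    ((summable_geometric_of_lt_one hq0 hq1).mul_left C).comp_injective PNat.coe_injective
  have hfin : ∑' N, P (s N) ≠ ∞ := by
    refine ne_top_of_le_ne_top hs.tsum_ofReal_ne_top (ENNReal.tsum_le_tsum fun N => ?_)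
    rw [← ofReal_measureReal]
    exact ENNReal.ofReal_le_ofReal (h N)
  filter_upwards [ae_finite_setOfPred_mem hfin] with ω hω
  exact atTop_le_cofinite hω.compl_mem_cofinite

/-- With outward drift `2θ - 1`, the hitting time is close to `N / (2θ - 1)`. -/
lemma ae_eventually_hitTime_near (hW : ∀ N : ℕ+, IsWalk P θ N (X N)) (h : 1 / 2 < θ) (h1 : θ ≤ 1)
    {ε : ℝ} (hε : 0 < ε) (hε1 : ε ≤ 1) :
    ∀ᵐ ω ∂P, ∀ᶠ N : ℕ+ in atTop, ∀ m : ℕ, hitTime N (X N) ω = m →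
      |(m : ℝ) / N - 1 / (2 * θ - 1)| ≤ ε / (2 * θ - 1) + 1 / N := by
  have hμ : 0 < 2 * θ - 1 := by linarith
  obtain ⟨q, hq0, hq1, hq⟩ := exists_survival_le_pow h h1 hε
  obtain ⟨C, r, hr0, hr1, hr⟩ := exists_one_sub_survival_le_pow h h1 hε hε1
  have hup := ae_eventually_notMem_of_le_pow (P := P) (C := 1) (s := fun N : ℕ+ =>
      {ω | ((⌈(1 + ε) * N / (2 * θ - 1)⌉₊ : ℕ) : ℕ∞) < hitTime N (X N) ω}) hq0 hq1 fun N => by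
    rw [(hW N).measureReal_lt_hitTime N.pos, one_mul]
    exact hq N N.pos _ (Nat.le_ceil _)
  have hlow := ae_eventually_notMem_of_le_pow (P := P) (s := fun N : ℕ+ =>
      {ω | ((⌊(1 - ε) * N / (2 * θ - 1)⌋₊ : ℕ) : ℕ∞) < hitTime N (X N) ω}ᶜ) hr0 hr1 fun N => by
    rw [probReal_compl_eq_one_sub (measurableSet_lt_hitTime (hW N).measurable _),
      (hW N).measureReal_lt_hitTime N.pos]
    exact hr N N.pos _ (Nat.floor_le (div_nonneg
      (mul_nonneg (by linarith) (Nat.cast_nonneg _)) hμ.le))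
  filter_upwards [hup, hlow] with ω hω1 hω2
  filter_upwards [hω1, hω2] with N hN1 hN2 m hm
  have hN : (0 : ℝ) < N := Nat.cast_pos.2 N.pos
  simp only [Set.mem_ofPred_eq, Set.mem_compl_iff, hm, Nat.cast_lt, not_lt, not_le] at hN1 hN2
  -- The `+ 1` from rounding up becomes the `1 / N` in the bound.
  have e1 : (m : ℝ) < (1 + ε) * N / (2 * θ - 1) + 1 :=
    (Nat.cast_le.2 hN1).trans_lt (Nat.ceil_lt_add_one (by positivity))
  have e2 : (1 - ε) * N / (2 * θ - 1) < m := Nat.lt_of_floor_lt hN2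
  have e3 : (m : ℝ) / N < 1 / (2 * θ - 1) + (ε / (2 * θ - 1) + 1 / N) := by
    rw [div_lt_iff₀ hN]
    refine e1.trans_eq ?_
    field_simp
    ring
  have e4 : 1 / (2 * θ - 1) - ε / (2 * θ - 1) < (m : ℝ) / N := by
    rw [lt_div_iff₀ hN]
    refine Eq.trans_lt ?_ e2
    ring
  have e5 : (0 : ℝ) < 1 / N := one_div_pos.2 hN
  rw [abs_le]
  constructor <;> linarith

lemma ae_tendsto_normalized (hW : ∀ N : ℕ+, IsWalk P θ N (X N)) (h : 1 / 2 < θ) (h1 : θ ≤ 1) :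
    ∀ᵐ ω ∂P, Tendsto (fun N : ℕ+ => normalized P (hitTime N (X N)) ω) atTop (𝓝 1) := by
  have h0 : 0 < θ := by linarith
  have hμ : 0 < 2 * θ - 1 := by linarith
  -- Only the countably many values `ε = 1 / (j + 1)` are used, so that one null set serves them
  -- all.
  have hnear : ∀ᵐ ω ∂P, ∀ j : ℕ, ∀ᶠ N : ℕ+ in atTop, ∀ m : ℕ, hitTime N (X N) ω = m →
      |(m : ℝ) / N - 1 / (2 * θ - 1)| ≤ 1 / ((j : ℝ) + 1) / (2 * θ - 1) + 1 / N :=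
    ae_all_iff.2 fun j => ae_eventually_hitTime_near hW h h1 Nat.one_div_pos_of_nat
      (by rw [div_le_one (by positivity)]; linarith [(Nat.cast_nonneg j : (0 : ℝ) ≤ j)])
  filter_upwards [hnear, ae_all_iff.2 fun N : ℕ+ => (hW N).ae_normalized_eq N.pos h0 h1]
    with ω hω hn
  choose m hm hnorm using hn
  have hinv : Tendsto (fun N : ℕ+ => 1 / (N : ℝ)) atTop (𝓝 0) :=
    tendsto_one_div_atTop_nhds_zero_nat.comp tendsto_PNat_val_atTop_atTop
  have hm1 : Tendsto (fun N : ℕ+ => (m N : ℝ) / N) atTop (𝓝 (1 / (2 * θ - 1))) := by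
    rw [Metric.tendsto_nhds]
    intro δ hδ
    have hj : Tendsto (fun j : ℕ => 1 / ((j : ℝ) + 1) / (2 * θ - 1)) atTop (𝓝 0) := by
      simpa using tendsto_one_div_add_atTop_nhds_zero_nat.div_const (2 * θ - 1)
    obtain ⟨j, hj⟩ := (hj.eventually (gt_mem_nhds (half_pos hδ))).exists
    filter_upwards [hω j, hinv.eventually (gt_mem_nhds (half_pos hδ))] with N hN hN2
    rw [Real.dist_eq]
    linarith [hN (m N) (hm N)]
  have hE := (tendsto_expectedTime_div h h1).comp tendsto_PNat_val_atTop_atTop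
  -- `τ / E = (τ / N) / (E / N)`, where both ratios have the same positive limit.
  have hlim := hm1.div hE (by positivity)
  rw [div_self (by positivity)] at hlim
  refine hlim.congr fun N => ?_
  have hN : (0 : ℝ) < N := Nat.cast_pos.2 N.pos
  have hE0 := one_le_expectedTime h0 h1 N.pos
  simp only [hnorm, Pi.div_apply, Function.comp_apply]
  field_simp

/-- Almost sure convergence to `1` implies cut-off. -/
lemma cutOff_of_ae_tendsto {τ : ℕ+ → Ω → ℕ∞} (hm : ∀ N, Measurable (normalized P (τ N)))
    (h : ∀ᵐ ω ∂P, Tendsto (fun N : ℕ+ => normalized P (τ N) ω) atTop (𝓝 1)) :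
    CutOff (fun _ => P) τ := by
  refine ⟨1 / 2, 2, by norm_num, by norm_num, ?_⟩
  have hs : ∀ N, MeasurableSet {ω | 1 / 2 < normalized P (τ N) ω ∧ normalized P (τ N) ω < 2} :=
    fun N => hm N measurableSet_Ioo
  have key : Tendsto (fun N : ℕ+ => P {ω | 1 / 2 < normalized P (τ N) ω ∧
      normalized P (τ N) ω < 2}) atTop (𝓝 (P Set.univ)) := by
    refine tendsto_measure_of_ae_tendsto_indicator_of_isFiniteMeasure atTop MeasurableSet.univ hs ?_
    filter_upwards [h] with ω hω
    filter_upwards [hω.eventually (Ioo_mem_nhds (by norm_num : (1 / 2 : ℝ) < 1) one_lt_two)]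
      with N hN
    exact iff_of_true hN trivial
  simpa [measureReal_def, Function.comp_def] using
    (ENNReal.tendsto_toReal (measure_ne_top P _)).comp key

end CutOff

end SingleWell

theorem mainTheorem5 :
    (∀ θ : ℝ, 0 < θ → θ < 1 / 2 →
      ∀ (Ω : ℕ+ → Type*) [∀ N, MeasurableSpace (Ω N)] (P : ∀ N, Measure (Ω N))
        [∀ N, IsProbabilityMeasure (P N)] (X : ∀ N, ℕ → Ω N → ℤ),
        (∀ N : ℕ+, SingleWell.IsWalk (P N) θ N (X N)) →
        (∀ N : ℕ+, 0 < SingleWell.mean (P N) (SingleWell.hitTime N (X N)) ∧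
          SingleWell.mean (P N) (SingleWell.hitTime N (X N)) < ∞) ∧
        TendstoInDistribution
          (fun N : ℕ+ => SingleWell.normalized (P N) (SingleWell.hitTime N (X N)))
          atTop (id : ℝ → ℝ) P (expMeasure 1) ∧
        SingleWell.Metastable P (fun N : ℕ+ => SingleWell.hitTime N (X N))) ∧
    (∀ θ : ℝ, 1 / 2 < θ → θ ≤ 1 →
      ∀ (Ω : Type*) [MeasurableSpace Ω] (P : Measure Ω) [IsProbabilityMeasure P]
        (X : ℕ+ → ℕ → Ω → ℤ),
        (∀ N : ℕ+, SingleWell.IsWalk P θ N (X N)) →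
        (∀ N : ℕ+, 0 < SingleWell.mean P (SingleWell.hitTime N (X N)) ∧
          SingleWell.mean P (SingleWell.hitTime N (X N)) < ∞) ∧
        (∀ᵐ ω ∂P, Tendsto
          (fun N : ℕ+ => SingleWell.normalized P (SingleWell.hitTime N (X N)) ω)
          atTop (𝓝 1)) ∧
        SingleWell.CutOff (fun _ => P) (fun N : ℕ+ => SingleWell.hitTime N (X N))) := by
  refine ⟨fun θ h0 h Ω _ P _ X hW => ⟨fun N => (hW N).mean_pos_lt_top N.pos h0 (by linarith), ?_,
    SingleWell.metastable_hitTime hW h0 h⟩, fun θ h h1 Ω _ P _ X hW =>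
    ⟨fun N => (hW N).mean_pos_lt_top N.pos (by linarith) h1,
      SingleWell.ae_tendsto_normalized hW h h1, ?_⟩⟩
  · exact SingleWell.tendstoInDistribution_exp
      (fun N => SingleWell.measurable_normalized (hW N).measurable)
      (fun _ _ => ENNReal.toReal_nonneg) (SingleWell.metastable_hitTime hW h0 h)
  · exact SingleWell.cutOff_of_ae_tendsto
      (fun N => SingleWell.measurable_normalized (hW N).measurable)
      (SingleWell.ae_tendsto_normalized hW h h1)
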